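/- Let $M$ be a matroid on a finite set $E$, with family of bases $\mathcal{B}$, and let $\mathcal{N}\in\{0,1\}^{\mathcal{B}\times E}$ be the matrix whose rows are the indicator vectors $\mathbb{1}_B$ of the bases $B\in\mathcal{B}$. For $\lambda\in\mathbb{R}^E_{>0}$ put $\lambda[B]=\prod_{e\in B}\lambda(e)$, let $\mu_\lambda$ be the probability mass function on $\mathcal{B}$ given by $\mu_\lambda(B)=\lambda[B]/\sum_{B'\in\mathcal{B}}\lambda[B']$, and let $\eta_\lambda=\mathcal{N}^T\mu_\lambda\in\mathbb{R}^E$, that is, $\eta_\lambda(e)=\sum_{B\ni e}\mu_\lambda(B)$. Let $\operatorname{conv}(\mathcal{B})$ be the convex hull of $\{\mathbb{1}_B : B\in\mathcal{B}\}$, and let $\operatorname{conv}^+(\mathcal{B})$ be the set of all $\beta\in\operatorname{conv}(\mathcal{B})$ such that every base belongs to the support of some probability mass function $\mu$ on $\mathcal{B}$ with $\mathcal{N}^T\mu=\beta$. A separator of $M$ is a set $X\subseteq E$ such that each circuit of $M$ is contained in $X$ or in $E\setminus X$; a connected component of $M$ is a minimal nonempty separator; $M$ is connected if its only separators are $\emptyset$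 and $E$. **Theorem.** Let $\beta\in\operatorname{conv}^+(\mathcal{B})$. Then there exists $\lambda\in\mathbb{R}^E_{>0}$ with $\eta_\lambda=\beta$, and it is unique up to independent positive rescalings on the connected components of $M$. That is, if $\lambda\in\mathbb{R}^E_{>0}$ satisfies $\eta_\lambda=\beta$, then a vector $\tilde\lambda\in\mathbb{R}^E$ is positive in every coordinate and satisfies $\eta_{\tilde\lambda}=\beta$ if and only if there are constants $\lambda_C>0$, one for each connected component $C$ of $M$, such that $\tilde\lambda(e)=\lambda_C\,\lambda(e)$ for every component $C$ and every $e\in C$. In particular, if $M$ is connected, then $\lambda$ is unique up to multiplication by one positive constant. -/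

import Mathlib

open scoped Matrix

noncomputable section

namespace MatroidUsage

variable {E : Type*} [Fintype E]

open Classical in
/-- The family `𝓑(M)` of bases of a matroid on a finite type, as a finset of finsets. -/
def bases (M : Matroid E) : Finset (Finset E) :=
  Finset.univ.filter fun B => M.IsBase (B : Set E)

/-- The usage matrix `𝒩`: its rows are the `0/1` indicator vectors of the bases. -/
def usage (M : Matroid E) : Matrix (bases M) E ℝ :=
  Matrix.of fun B => ((B : Finset E) : Set E).indicator 1

/-- `conv(𝓑)`: the convex hull in `ℝ^E` of the indicator vectors of the bases. -/
def baseConv (M : Matroid E) : Set (E → ℝ) :=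
  convexHull ℝ (Set.range (usage M).row)

/-- `𝒰_β`: the probability mass functions `μ` on the bases with `𝒩ᵀ μ = β`. -/
def inducedPmfs (M : Matroid E) (β : E → ℝ) : Set (bases M → ℝ) :=
  {μ | μ ∈ stdSimplex ℝ (bases M) ∧ (usage M)ᵀ *ᵥ μ = β}

/-- `𝓑_β`: the bases in the support of some `μ ∈ 𝒰_β`. -/
def supportedBases (M : Matroid E) (β : E → ℝ) : Set (bases M) :=
  ⋃ μ ∈ inducedPmfs M β, Function.support μ

/-- `conv⁺(𝓑)`: the vectors `β ∈ conv(𝓑)` with `𝓑_β = 𝓑`. -/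
def baseConvPlus (M : Matroid E) : Set (E → ℝ) :=
  {β | β ∈ baseConv M ∧ supportedBases M β = Set.univ}

/-- `λ[B] = ∏_{e ∈ B} λ(e)`. -/
def baseWeight (M : Matroid E) (l : E → ℝ) (B : bases M) : ℝ :=
  ∏ e ∈ (B : Finset E), l e

/-- `μ_λ`: the probability mass function on the bases proportional to `λ[B]`. -/
def weightPmf (M : Matroid E) (l : E → ℝ) (B : bases M) : ℝ :=
  baseWeight M l B / ∑ B' : bases M, baseWeight M l B'

/-- `η_λ = 𝒩ᵀ μ_λ`: the element usage induced by `μ_λ`. -/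
def weightUsage (M : Matroid E) (l : E → ℝ) : E → ℝ :=
  (usage M)ᵀ *ᵥ weightPmf M l

/-- For positive weights, `μ_λ` is indeed a probability mass function. -/
theorem weightPmf_mem_stdSimplex (M : Matroid E) (l : E → ℝ) (hl : ∀ e, 0 < l e) :
    weightPmf M l ∈ stdSimplex ℝ (bases M) := by
  have hpos : ∀ B, 0 < baseWeight M l B := fun B => Finset.prod_pos fun e _ => hl e
  obtain ⟨B, hB⟩ := M.exists_isBase
  have : Nonempty (bases M) := ⟨⟨B.toFinite.toFinset, by simpa [bases] using hB⟩⟩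
  have hS : 0 < ∑ B' : bases M, baseWeight M l B' :=
    Finset.sum_pos (fun B _ => hpos B) Finset.univ_nonempty
  refine ⟨fun B => (div_pos (hpos B) hS).le, ?_⟩
  simp only [weightPmf]
  rw [← Finset.sum_div, div_self hS.ne']

end MatroidUsage

namespace MatroidUsage

variable {E : Type*}

/-- A separator: a set `X` of elements such that every circuit lies in `X` or in `E - X`. -/
def IsSeparator (M : Matroid E) (X : Set E) : Prop :=
  X ⊆ M.E ∧ ∀ C, M.IsCircuit C → C ⊆ X ∨ C ⊆ M.E \ X

/-- A matroid is connected if its only separators are the empty set and the ground set. -/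
def IsConnected (M : Matroid E) : Prop :=
  ∀ X, IsSeparator M X → X = ∅ ∨ X = M.E

/-- A connected component: a minimal nonempty separator. -/
def IsComponent (M : Matroid E) (C : Set E) : Prop :=
  Minimal (fun X => IsSeparator M X ∧ X.Nonempty) C

end MatroidUsage

end

/-! Write `λ = exp x`. Up to a positive factor, `η_λ - β` is the gradient at `x` of the convex
function `x ↦ ∑_B exp ⟪x, 1_B - β⟫`, so solutions are its critical points. Existence: `β ∈ conv⁺`
makes some strictly positive combination of the vectors `1_B - β` vanish. This bounds all exponents
on a sublevel set, so a minimum is attained. Uniqueness: by strict monotonicity of `exp`, two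
critical points have the same exponents, so their difference `d` has the same sum over every base.
Base exchange turns this into `d` being constant on circuits, hence on components; conversely, such
a shift scales all base weights equally and cancels in `μ_λ`. -/

open Finset in
/-- If positive multiples of the vectors `v i` sum to zero, the function
`x ↦ ∑ i, exp ⟪x, v i⟫` has a critical point. -/
theorem exists_sum_exp_mul_eq_zero {ι E : Type*} [Fintype ι] [Fintype E]
    (v : ι → E → ℝ) (μ : ι → ℝ) (hμ : ∀ i, 0 < μ i) (h : ∀ e, ∑ i, μ i * v i e = 0) :
    ∃ x : E → ℝ, ∀ e, ∑ i, Real.exp (∑ a, x a * v i a) * v i e = 0 := by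
  classical
  let A : (E → ℝ) →ₗ[ℝ] (ι → ℝ) := (Matrix.of v).mulVecLin
  have hA : ∀ x i, A x i = ∑ a, x a * v i a := fun x i => by
    simp [A, Matrix.mulVec, dotProduct, mul_comm]
  have hAμ : ∀ x, ∑ i, μ i * A x i = 0 := fun x => by
    simp only [hA, mul_sum]
    rw [sum_comm]
    refine sum_eq_zero fun a _ => ?_
    rw [← mul_zero (x a), ← h a, mul_sum]
    exact sum_congr rfl fun i _ => by ring
  let F : (ι → ℝ) → ℝ := fun y => ∑ i, Real.exp (y i)
  have hF : Continuous F := by fun_prop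
  set U : ℝ := (Fintype.card ι : ℝ)
  -- Minimise over exponent vectors `A x`, since the kernel of `A` makes sublevel sets in `x`
  -- unbounded. `U` is the value at `x = 0`; each exponent is at most `U`, and `∑ μ j * A x j = 0`
  -- then gives the lower bound.
  let S : Set (ι → ℝ) := Set.Icc (fun i => -(U * ∑ j, μ j) / μ i) (fun _ => U) ∩ A.range
  have hS : IsCompact S := isCompact_Icc.inter_right (Submodule.closed_of_finiteDimensional _)
  have hsub : ∀ x, F (A x) ≤ U → A x ∈ S := fun x hx => by
    have hle : ∀ i, A x i ≤ U := fun i => calc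
      A x i ≤ Real.exp (A x i) := by linarith [Real.add_one_le_exp (A x i)]
      _ ≤ F (A x) := single_le_sum (f := fun i => Real.exp (A x i))
        (fun _ _ => (Real.exp_pos _).le) (mem_univ i)
      _ ≤ U := hx
    refine ⟨⟨fun i => ?_, hle⟩, LinearMap.mem_range_self A x⟩
    rw [div_le_iff₀ (hμ i)]
    have h1 : ∑ j ∈ univ.erase i, μ j * A x j ≤ ∑ j ∈ univ.erase i, μ j * U :=
      sum_le_sum fun j _ => mul_le_mul_of_nonneg_left (hle j) (hμ j).le
    have h2 : ∑ j ∈ univ.erase i, μ j * U ≤ ∑ j, μ j * U :=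
      sum_le_sum_of_subset_of_nonneg (erase_subset _ _)
        fun j _ _ => mul_nonneg (hμ j).le (Nat.cast_nonneg _)
    have h3 := add_sum_erase univ (fun j => μ j * A x j) (mem_univ i)
    simp only [hAμ] at h3
    have h4 : ∑ j, μ j * U = (∑ j, μ j) * U := (sum_mul _ _ _).symm
    linarith
  have hF0 : F (A 0) = U := by simp [F, U]
  obtain ⟨y, hyS, hy⟩ := hS.exists_isMinOn ⟨A 0, hsub 0 hF0.le⟩ hF.continuousOn
  obtain ⟨x, rfl⟩ := hyS.2
  have hmin : ∀ z, F (A x) ≤ F (A z) := fun z => by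
    by_cases hz : F (A z) ≤ U
    · exact hy (hsub z hz)
    · have : F (A x) ≤ F (A 0) := hy (hsub 0 hF0.le)
      linarith
  refine ⟨x, fun e => ?_⟩
  have hd : HasDerivAt (fun t : ℝ => F (A (x + t • Pi.single e 1)))
      (∑ i, Real.exp (A x i) * v i e) 0 := by
    have he : ∀ i, A (Pi.single e 1) i = v i e := fun i => by simp [A]
    simp only [F, map_add, map_smul, Pi.add_apply, Pi.smul_apply, he, smul_eq_mul]
    refine HasDerivAt.fun_sum fun i _ => ?_
    simpa using (((hasDerivAt_id (0 : ℝ)).mul_const (v i e)).const_add (A x i)).exp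
  have hloc : IsLocalMin (fun t : ℝ => F (A (x + t • Pi.single e 1))) 0 :=
    Filter.Eventually.of_forall fun t => by
      simpa only [zero_smul, add_zero] using hmin (x + t • Pi.single e 1)
  simpa only [hA] using hloc.hasDerivAt_eq_zero hd

/-- Critical points of `x ↦ ∑ i, exp ⟪x, v i⟫` differ by vectors orthogonal to all `v i`. -/
theorem sum_mul_eq_of_sum_exp_mul_eq_zero {ι E : Type*} [Fintype ι] [Fintype E]
    (v : ι → E → ℝ) {x y : E → ℝ}
    (hx : ∀ e, ∑ i, Real.exp (∑ a, x a * v i a) * v i e = 0)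
    (hy : ∀ e, ∑ i, Real.exp (∑ a, y a * v i a) * v i e = 0) (i : ι) :
    ∑ a, x a * v i a = ∑ a, y a * v i a := by
  have key : ∀ w z : E → ℝ, (∀ e, ∑ i, Real.exp (∑ a, w a * v i a) * v i e = 0) →
      ∑ i, Real.exp (∑ a, w a * v i a) * ∑ a, z a * v i a = 0 := fun w z hw => by
    simp only [Finset.mul_sum]
    rw [Finset.sum_comm]
    refine Finset.sum_eq_zero fun a _ => ?_
    rw [← mul_zero (z a), ← hw a, Finset.mul_sum]
    exact Finset.sum_congr rfl fun i _ => by ring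
  have hnn : ∀ s t : ℝ, 0 ≤ (Real.exp s - Real.exp t) * (s - t) := fun s t => by
    rcases le_total s t with h | h
    · exact mul_nonneg_of_nonpos_of_nonpos (sub_nonpos.2 (Real.exp_le_exp.2 h)) (sub_nonpos.2 h)
    · exact mul_nonneg (sub_nonneg.2 (Real.exp_le_exp.2 h)) (sub_nonneg.2 h)
  -- Pair the difference of the two critical equations with `x - y`. The terms are nonnegative, so
  -- each one vanishes.
  have hsum : ∑ i, (Real.exp (∑ a, x a * v i a) - Real.exp (∑ a, y a * v i a)) *
      (∑ a, x a * v i a - ∑ a, y a * v i a) = 0 := by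
    simp only [sub_mul, mul_sub, Finset.sum_sub_distrib, key x x hx, key x y hx, key y x hy,
      key y y hy, sub_self]
  have h0 := (Finset.sum_eq_zero_iff_of_nonneg fun i _ => hnn _ _).1 hsum i (Finset.mem_univ i)
  rcases mul_eq_zero.1 h0 with h | h
  · exact Real.exp_injective (sub_eq_zero.1 h)
  · exact sub_eq_zero.1 h

theorem exists_eq_exp {E : Type*} {l : E → ℝ} (hl : ∀ e, 0 < l e) :
    ∃ x : E → ℝ, l = fun e => Real.exp (x e) :=
  ⟨fun e => Real.log (l e), funext fun e => (Real.exp_log (hl e)).symm⟩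

namespace MatroidUsage

/-! ### Separators, components and base exchange -/

section Separators

variable {E : Type*} {M : Matroid E}

theorem IsSeparator.inter {X Y : Set E} (hX : IsSeparator M X) (hY : IsSeparator M Y) :
    IsSeparator M (X ∩ Y) := by
  refine ⟨fun e he => hX.1 he.1, fun C hC => ?_⟩
  have := hC.subset_ground
  rcases hX.2 C hC with h | h <;> rcases hY.2 C hC with h' | h'
  · exact Or.inl fun e he => ⟨h he, h' he⟩
  · exact Or.inr fun e he => ⟨this he, fun hn => (h' he).2 hn.2⟩
  · exact Or.inr fun e he => ⟨this he, fun hn => (h he).2 hn.1⟩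
  · exact Or.inr fun e he => ⟨this he, fun hn => (h he).2 hn.1⟩

theorem IsSeparator.compl {X : Set E} (hX : IsSeparator M X) : IsSeparator M (M.E \ X) := by
  refine ⟨Set.sdiff_subset, fun C hC => ?_⟩
  rw [Set.sdiff_sdiff_cancel_left hX.1]
  exact (hX.2 C hC).symm

theorem isSeparator_ground : IsSeparator M M.E :=
  ⟨subset_rfl, fun _ hC => Or.inl hC.subset_ground⟩

theorem IsComponent.subset_of_mem {C X : Set E} (hC : IsComponent M C) (hX : IsSeparator M X)
    {e : E} (heC : e ∈ C) (heX : e ∈ X) : C ⊆ X :=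
  (hC.2 ⟨hC.1.1.inter hX, e, heC, heX⟩ Set.inter_subset_left).trans Set.inter_subset_right

theorem IsComponent.eq_of_mem {C D : Set E} (hC : IsComponent M C) (hD : IsComponent M D)
    {e : E} (heC : e ∈ C) (heD : e ∈ D) : C = D :=
  (hC.subset_of_mem hD.1.1 heC heD).antisymm (hD.subset_of_mem hC.1.1 heD heC)

theorem exists_isComponent_mem [Finite E] {e : E} (he : e ∈ M.E) :
    ∃ C, IsComponent M C ∧ e ∈ C := by
  obtain ⟨C, hC⟩ := (Set.toFinite {X : Set E | IsSeparator M X ∧ e ∈ X}).exists_minimal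
    ⟨M.E, isSeparator_ground, he⟩
  refine ⟨C, ⟨⟨hC.1.1, e, hC.1.2⟩, fun Y ⟨hY, hne⟩ hYC => ?_⟩, hC.1.2⟩
  by_cases heY : e ∈ Y
  · exact hC.2 ⟨hY, heY⟩ hYC
  -- A nonempty separator `Y ⊆ C` missing `e` contradicts minimality: `C \ Y` is a smaller separator
  -- containing `e`.
  · obtain ⟨f, hf⟩ := hne
    have := hC.2 (y := C ∩ (M.E \ Y)) ⟨hC.1.1.inter hY.compl, hC.1.2, he, heY⟩
      Set.inter_subset_left (hYC hf)
    exact absurd hf this.2.2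

/-- `d` takes a single value on each circuit of `M`. -/
def ConstOnCircuits (M : Matroid E) (d : E → ℝ) : Prop :=
  ∀ C, M.IsCircuit C → ∀ e ∈ C, ∀ f ∈ C, d e = d f

/-- No circuit crosses a level set of `d`; this forces `d` to be constant on components. -/
theorem ConstOnCircuits.isSeparator {d : E → ℝ} (hd : ConstOnCircuits M d) (r : ℝ) :
    IsSeparator M {e ∈ M.E | d e = r} := by
  refine ⟨fun e he => he.1, fun C hC => ?_⟩
  have hCE := hC.subset_ground
  by_cases h : ∃ e ∈ C, d e = r
  · obtain ⟨e, he, hr⟩ := h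
    exact Or.inl fun f hf => ⟨hCE hf, (hd C hC f hf e he).trans hr⟩
  · exact Or.inr fun f hf => ⟨hCE hf, fun hn => h ⟨f, hf, hn.2⟩⟩

theorem constOnCircuits_iff_components [Finite E] {d : E → ℝ} :
    ConstOnCircuits M d ↔ ∀ C, IsComponent M C → ∀ e ∈ C, ∀ f ∈ C, d e = d f := by
  refine ⟨fun hd C hC e he f hf => ?_, fun h C hC e he f hf => ?_⟩
  · exact (hC.subset_of_mem (hd.isSeparator (d f)) hf ⟨hC.1.1.1 hf, rfl⟩ he).2
  · obtain ⟨D, hD, heD⟩ := exists_isComponent_mem (hC.subset_ground he)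
    rcases hD.1.1.2 C hC with h' | h'
    · exact h D hD e heD f (h' hf)
    · exact absurd heD (h' he).2

theorem constOnCircuits_iff_of_isConnected (hM : IsConnected M) {d : E → ℝ} :
    ConstOnCircuits M d ↔ ∀ e ∈ M.E, ∀ f ∈ M.E, d e = d f := by
  refine ⟨fun hd e he f hf => ?_, fun h C hC e he f hf =>
    h e (hC.subset_ground he) f (hC.subset_ground hf)⟩
  have hf' : f ∈ {a ∈ M.E | d a = d f} := ⟨hf, rfl⟩
  rcases hM _ (hd.isSeparator (d f)) with h | h
  · rw [h] at hf'
    exact hf'.elim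
  · rw [← h] at he
    exact he.2

/-- Two distinct elements of a circuit can be exchanged between two bases. -/
theorem exists_isBase_exchange_of_isCircuit {C : Set E} (hC : M.IsCircuit C) {e f : E}
    (he : e ∈ C) (hf : f ∈ C) (hef : e ≠ f) :
    ∃ B, M.IsBase B ∧ f ∈ B ∧ e ∉ B ∧ M.IsBase (insert e (B \ {f})) := by
  obtain ⟨B, hB, hCB⟩ := (hC.sdiff_singleton_indep he).exists_isBase_superset
  have heB : e ∉ B := fun heB => hC.not_indep <| hB.indep.subset fun a ha => by
    by_cases hae : a = e
    · exact hae ▸ heB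
    · exact hCB ⟨ha, hae⟩
  have hCi : C ⊆ insert e B := fun a ha => by
    by_cases hae : a = e
    · exact Or.inl hae
    · exact Or.inr (hCB ⟨ha, hae⟩)
  have hecl : e ∈ M.closure B := by
    rw [hB.closure_eq]
    exact hC.subset_ground he
  -- As `B` contains `C \ {e}`, the fundamental circuit of `e` is `C` itself, so any `f ∈ C` can be
  -- traded for `e`.
  have hfC : f ∈ M.fundCircuit e B := hC.eq_fundCircuit_of_subset hB.indep hCi ▸ hf
  have hI := (hB.indep.mem_fundCircuit_iff hecl heB).1 hfC
  refine ⟨B, hB, hCB ⟨hf, hef.symm⟩, heB, ?_⟩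
  rw [Set.insert_sdiff_singleton_comm hef]
  exact hB.exchange_isBase_of_indep' (hCB ⟨hf, hef.symm⟩) heB hI

/-- Two elements exchanged between two bases lie in a common circuit. -/
theorem exists_isCircuit_of_isBase_exchange {B : Set E} (hB : M.IsBase B) {e f : E}
    (he : e ∈ B) (hf : f ∉ B) (hB' : M.IsBase (insert f (B \ {e}))) :
    ∃ C, M.IsCircuit C ∧ e ∈ C ∧ f ∈ C := by
  have hfE : f ∈ M.E := hB'.subset_ground (Set.mem_insert _ _)
  have hfcl : f ∈ M.closure B := by rwa [hB.closure_eq]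
  refine ⟨_, hB.fundCircuit_isCircuit hfE hf, ?_, M.mem_fundCircuit f B⟩
  rw [hB.indep.mem_fundCircuit_iff hfcl hf,
    ← Set.insert_sdiff_singleton_comm (ne_of_mem_of_not_mem he hf).symm]
  exact hB'.indep

/-- A weighting of the elements gives all bases the same sum exactly when it is constant on
circuits. -/
theorem constOnCircuits_iff_sum_eq [Finite E] {d : E → ℝ} :
    ConstOnCircuits M d ↔ ∀ B B' : Finset E, M.IsBase (B : Set E) → M.IsBase (B' : Set E) →
      ∑ e ∈ B, d e = ∑ e ∈ B', d e := by
  classical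
  constructor
  · intro hd B B' hB hB'
    -- Each exchange moves `B` closer to `B'` and swaps two elements of a common circuit, preserving
    -- the sum.
    induction hn : (B \ B').card generalizing B with
    | zero =>
      rw [Finset.card_eq_zero, Finset.sdiff_eq_empty_iff_subset] at hn
      have := hB.eq_of_subset_isBase hB' (Finset.coe_subset.2 hn)
      rw [Finset.coe_injective this]
    | succ n ih =>
      obtain ⟨e, he⟩ : (B \ B').Nonempty := Finset.card_pos.1 (by omega)
      obtain ⟨heB, heB'⟩ := Finset.mem_sdiff.1 he
      obtain ⟨f, ⟨hfB', hfB⟩, hB₁⟩ := hB.exchange_mem hB' (e := e) (by simpa using heB)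
        (by simpa using heB')
      obtain ⟨C, hC, heC, hfC⟩ := exists_isCircuit_of_isBase_exchange hB (by simpa using heB)
        hfB hB₁
      have hfB : f ∉ B := by simpa using hfB
      have hfB' : f ∈ B' := by simpa using hfB'
      have hcard : (insert f (B.erase e) \ B').card = n := by
        rw [Finset.insert_sdiff_of_mem _ hfB', Finset.erase_sdiff_comm, Finset.card_erase_of_mem he,
          hn, Nat.add_sub_cancel]
      rw [← ih (insert f (B.erase e)) (by simpa using hB₁) hcard,
        Finset.sum_insert fun h => hfB (Finset.mem_of_mem_erase h),
        ← Finset.add_sum_erase B d heB, hd C hC e heC f hfC]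
  · intro h C hC e he f hf
    by_cases hef : e = f
    · rw [hef]
    obtain ⟨B, hB, hfB, heB, hB'⟩ := exists_isBase_exchange_of_isCircuit hC he hf hef
    obtain ⟨B, rfl⟩ := B.toFinite.exists_finset_coe
    have hfB : f ∈ B := by simpa using hfB
    have heB : e ∉ B := by simpa using heB
    have := h B (insert e (B.erase f)) hB (by simpa using hB')
    rw [Finset.sum_insert fun h => heB (Finset.mem_of_mem_erase h),
      ← Finset.add_sum_erase B d hfB] at this
    linarith

end Separators

/-! ### Usage vectors as critical points -/

section Usage

variable {E : Type*} [Fintype E] {M : Matroid E}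

theorem isBase_of_mem_bases (B : bases M) : M.IsBase ((B : Finset E) : Set E) := by
  have := B.2
  simpa [bases] using this

theorem mem_bases {B : Finset E} (hB : M.IsBase (B : Set E)) : B ∈ bases M := by
  simpa [bases] using hB

theorem sum_mul_usage (x : E → ℝ) (B : bases M) :
    ∑ a, x a * usage M B a = ∑ a ∈ (B : Finset E), x a := by
  classical
  simp [usage, Set.indicator_apply]

theorem baseWeight_exp (x : E → ℝ) (B : bases M) :
    baseWeight M (fun e => Real.exp (x e)) B = Real.exp (∑ a ∈ (B : Finset E), x a) :=
  (Real.exp_sum _ _).symm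

/-- The equation `η_λ = β` with `λ = exp x` is a critical point equation. -/
theorem weightUsage_exp_eq_iff (x β : E → ℝ) :
    weightUsage M (fun e => Real.exp (x e)) = β ↔
      ∀ e, ∑ B : bases M, Real.exp (∑ a, x a * (usage M B a - β a)) * (usage M B e - β e) = 0 := by
  have hsum := (weightPmf_mem_stdSimplex M (fun e => Real.exp (x e)) fun e => Real.exp_pos _).2
  obtain ⟨Z, hZ⟩ : ∃ Z, Z = ∑ B : bases M, baseWeight M (fun e => Real.exp (x e)) B := ⟨_, rfl⟩
  have hw : ∀ B, weightPmf M (fun e => Real.exp (x e)) B =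
      Real.exp (∑ a ∈ (B : Finset E), x a) / Z := fun B => by
    rw [weightPmf, ← hZ, baseWeight_exp]
  -- With `Z = 0`, division by zero would make every weight `0`, yet they sum to `1`.
  have hZ0 : Z ≠ 0 := fun h => by
    simp only [hw, h, div_zero, Finset.sum_const_zero, zero_ne_one] at hsum
  rw [funext_iff]
  refine forall_congr' fun e => ?_
  have h1 : ∑ B : bases M, Real.exp (∑ a, x a * (usage M B a - β a)) * (usage M B e - β e) =
      Real.exp (-∑ a, x a * β a) * Z * (weightUsage M (fun e => Real.exp (x e)) e - β e) := by
    have h2 : weightUsage M (fun e => Real.exp (x e)) e - β e =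
        ∑ B : bases M, weightPmf M (fun e => Real.exp (x e)) B * (usage M B e - β e) := by
      simp only [mul_sub, Finset.sum_sub_distrib, ← Finset.sum_mul, hsum, one_mul]
      simp [weightUsage, Matrix.mulVec, dotProduct, mul_comm]
    rw [h2, Finset.mul_sum]
    refine Finset.sum_congr rfl fun B _ => ?_
    have h3 : ∑ a, x a * (usage M B a - β a) =
        -∑ a, x a * β a + ∑ a ∈ (B : Finset E), x a := by
      simp only [mul_sub, Finset.sum_sub_distrib, sum_mul_usage]
      ring
    rw [h3, Real.exp_add, hw]
    field_simp
  rw [h1, mul_eq_zero, or_iff_right (mul_ne_zero (Real.exp_ne_zero _) hZ0), sub_eq_zero]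

/-- A vector in `conv⁺(𝓑)` is a strictly positive combination of all bases. -/
theorem exists_pos_of_mem_baseConvPlus {β : E → ℝ} (hβ : β ∈ baseConvPlus M) :
    ∃ μ : bases M → ℝ, (∀ B, 0 < μ B) ∧ ∀ e, ∑ B, μ B * (usage M B e - β e) = 0 := by
  have h : ∀ B : bases M, ∃ μ ∈ inducedPmfs M β, μ B ≠ 0 := fun B => by
    have : B ∈ supportedBases M β := hβ.2 ▸ Set.mem_univ B
    simpa [supportedBases] using this
  choose ν hν hν0 using h
  -- Add one witness per base; the centred equation is homogeneous, so no normalisation is needed.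
  refine ⟨fun B => ∑ B', ν B' B, fun B => ?_, fun e => ?_⟩
  · exact Finset.sum_pos' (fun B' _ => (hν B').1.1 B)
      ⟨B, Finset.mem_univ B, ((hν B).1.1 B).lt_of_ne' (hν0 B)⟩
  · simp only [Finset.sum_mul]
    rw [Finset.sum_comm]
    refine Finset.sum_eq_zero fun B' _ => ?_
    have h1 := congrFun (hν B').2 e
    simp only [mul_sub, Finset.sum_sub_distrib, ← Finset.sum_mul, (hν B').1.2, one_mul]
    rw [← h1, sub_eq_zero]
    simp [Matrix.mulVec, dotProduct, mul_comm]

/-- Two positive weight vectors induce the same usage exactly when their log-ratio is constant on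
circuits. -/
theorem weightUsage_exp_eq_iff_constOnCircuits {x y β : E → ℝ}
    (hx : weightUsage M (fun e => Real.exp (x e)) = β) :
    weightUsage M (fun e => Real.exp (y e)) = β ↔ ConstOnCircuits M fun e => y e - x e := by
  rw [constOnCircuits_iff_sum_eq]
  constructor
  · intro hy
    have key : ∀ B : bases M, ∑ a ∈ (B : Finset E), (y a - x a) = ∑ a, (y a - x a) * β a :=
      fun B => by
        have h := sum_mul_eq_of_sum_exp_mul_eq_zero (fun (B : bases M) e => usage M B e - β e)
          ((weightUsage_exp_eq_iff y β).1 hy) ((weightUsage_exp_eq_iff x β).1 hx) B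
        simp only [mul_sub, Finset.sum_sub_distrib, sum_mul_usage, sub_mul] at h ⊢
        linarith
    intro B B' hB hB'
    exact (key ⟨B, mem_bases hB⟩).trans (key ⟨B', mem_bases hB'⟩).symm
  · intro h
    rw [← hx]
    obtain ⟨B₀, hB₀⟩ := M.exists_isBase
    obtain ⟨B₀, rfl⟩ := B₀.toFinite.exists_finset_coe
    have hw : ∀ B : bases M, baseWeight M (fun e => Real.exp (y e)) B =
        Real.exp (∑ a ∈ B₀, (y a - x a)) * baseWeight M (fun e => Real.exp (x e)) B := fun B => by
      rw [h B₀ B hB₀ (isBase_of_mem_bases B), baseWeight_exp, baseWeight_exp, ← Real.exp_add,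
        Finset.sum_sub_distrib, sub_add_cancel]
    unfold weightUsage
    congr 1
    funext B
    simp only [weightPmf, hw, ← Finset.mul_sum]
    exact mul_div_mul_left _ _ (Real.exp_ne_zero _)

end Usage

end MatroidUsage

open MatroidUsage in
theorem mainTheorem4 {E : Type*} [Fintype E] (M : Matroid E) (hE : M.E = Set.univ)
    (β : E → ℝ) (hβ : β ∈ MatroidUsage.baseConvPlus M) :
    -- existence
    (∃ l : E → ℝ, (∀ e, 0 < l e) ∧ MatroidUsage.weightUsage M l = β) ∧
    -- the solutions are exactly the independent positive rescalings, component by component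
    (∀ l : E → ℝ, (∀ e, 0 < l e) → MatroidUsage.weightUsage M l = β →
      ∀ l' : E → ℝ,
        ((∀ e, 0 < l' e) ∧ MatroidUsage.weightUsage M l' = β) ↔
          ∃ c : Set E → ℝ, (∀ C, MatroidUsage.IsComponent M C → 0 < c C) ∧
            ∀ C, MatroidUsage.IsComponent M C → ∀ e ∈ C, l' e = c C * l e) ∧
    -- for a connected matroid: one global positive rescaling
    (MatroidUsage.IsConnected M →
      ∀ l : E → ℝ, (∀ e, 0 < l e) → MatroidUsage.weightUsage M l = β →
        ∀ l' : E → ℝ,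
          ((∀ e, 0 < l' e) ∧ MatroidUsage.weightUsage M l' = β) ↔
            ∃ c : ℝ, 0 < c ∧ ∀ e, l' e = c * l e) := by
  refine ⟨?_, ?_, ?_⟩
  · obtain ⟨μ, hμ, h⟩ := exists_pos_of_mem_baseConvPlus hβ
    obtain ⟨x, hx⟩ := exists_sum_exp_mul_eq_zero _ μ hμ h
    exact ⟨_, fun e => Real.exp_pos (x e), (weightUsage_exp_eq_iff x β).2 hx⟩
  · intro l hl hlβ l'
    obtain ⟨x, rfl⟩ := exists_eq_exp hl
    constructor
    · rintro ⟨hl', hlβ'⟩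
      obtain ⟨y, rfl⟩ := exists_eq_exp hl'
      have hd := constOnCircuits_iff_components.1
        ((weightUsage_exp_eq_iff_constOnCircuits hlβ).1 hlβ')
      classical
      -- The ratio `l' / l` at any chosen element of `C`; the value `1` at `∅` is irrelevant, as
      -- components are nonempty.
      refine ⟨fun C => if h : C.Nonempty then Real.exp (y h.some - x h.some) else 1,
        fun C hC => ?_, fun C hC e he => ?_⟩
      · simp only [dif_pos hC.1.2, Real.exp_pos]
      · have hne : C.Nonempty := ⟨e, he⟩
        simp only [dif_pos hne]
        rw [← hd C hC e he _ hne.some_mem, ← Real.exp_add, sub_add_cancel]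
    · rintro ⟨c, hc, h⟩
      have hl' : ∀ e, 0 < l' e := fun e => by
        obtain ⟨C, hC, he⟩ := exists_isComponent_mem (M := M) (e := e) (hE ▸ Set.mem_univ e)
        rw [h C hC e he]
        exact mul_pos (hc C hC) (hl e)
      refine ⟨hl', ?_⟩
      obtain ⟨y, rfl⟩ := exists_eq_exp hl'
      rw [weightUsage_exp_eq_iff_constOnCircuits hlβ, constOnCircuits_iff_components]
      have key : ∀ C, IsComponent M C → ∀ e ∈ C, Real.exp (y e - x e) = c C := fun C hC e he => by
        rw [Real.exp_sub, show Real.exp (y e) = _ from h C hC e he,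
          mul_div_cancel_right₀ _ (Real.exp_ne_zero _)]
      exact fun C hC e he f hf => Real.exp_injective ((key C hC e he).trans (key C hC f hf).symm)
  · intro hM l hl hlβ l'
    obtain ⟨x, rfl⟩ := exists_eq_exp hl
    constructor
    · rintro ⟨hl', hlβ'⟩
      obtain ⟨y, rfl⟩ := exists_eq_exp hl'
      have hd := (constOnCircuits_iff_of_isConnected hM).1
        ((weightUsage_exp_eq_iff_constOnCircuits hlβ).1 hlβ')
      rcases isEmpty_or_nonempty E with hem | ⟨⟨a⟩⟩
      · exact ⟨1, one_pos, fun e => isEmptyElim e⟩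
      · refine ⟨Real.exp (y a - x a), Real.exp_pos _, fun e => ?_⟩
        rw [← hd e (hE ▸ Set.mem_univ e) a (hE ▸ Set.mem_univ a), ← Real.exp_add, sub_add_cancel]
    · rintro ⟨c, hc, h⟩
      have hl' : ∀ e, 0 < l' e := fun e => h e ▸ mul_pos hc (hl e)
      refine ⟨hl', ?_⟩
      obtain ⟨y, rfl⟩ := exists_eq_exp hl'
      rw [weightUsage_exp_eq_iff_constOnCircuits hlβ, constOnCircuits_iff_of_isConnected hM]
      have key : ∀ e, Real.exp (y e - x e) = c := fun e => by
        rw [Real.exp_sub, show Real.exp (y e) = _ from h e,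
          mul_div_cancel_right₀ _ (Real.exp_ne_zero _)]
      exact fun e _ f _ => Real.exp_injective ((key e).trans (key f).symm)
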